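/- For a vector $\Lambda=[\lambda_1,\dots,\lambda_N]$ of real numbers, $N\ge 2$, let $\phi=Q_N[\Lambda]$ be the TB-spline, i.e. the continuous compactly supported function whose Fourier transform $\hat f(\xi)=\int_{\mathbb R} f(t)e^{-i\xi t}\,dt$ is $$\hat\phi(\xi)=\prod_{j=1}^{N}\frac{e^{-\lambda_j}-e^{-i\xi}}{i\xi-\lambda_j};$$ equivalently, $\phi$ is the convolution of the functions $e^{\lambda_j(t-1)}\mathbf 1_{[0,1)}(t)$, $j=1,\dots,N$. Put $\phi^*(\xi)=\sum_{j\in\mathbb Z}\phi(j)e^{-i\xi j}$. When $\phi^*$ has no real zero, the Shannon--Walter exponential spline of $\Lambda$ is the function $S$ with Fourier transform $\hat\phi/\phi^*$, i.e. $$S(t)=\frac1{2\pi}\int_{\mathbb R}e^{i\xi t}\,\frac{\hat\phi(\xi)}{\phi^*(\xi)}\,d\xi .$$ Fix integers $n\ge 0$ and $p\ge1$. For a real parameter $k$ (in particular for integers $k\ge 0$) let $\Lambda_k$ be either the vector of order $N=2p$ with entries $k+2j$ and $-n-k+2+2j$ for $j=0,\dots,p-1$, or the vector of order $N=2p$ with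 $p$ entries equal to $-k$ and $p$ entries equal to $k$. For either family, for all sufficiently large $k$ we have $\phi^*(\xi)\ne0$ for all $\xi\in\mathbb R$, the function $\hat\phi/\phi^*$ is integrable, and the Shannon--Walter exponential spline $\widetilde S_0^{(k)}$ of $\Lambda_k$ is integrable with Fourier transform $\hat\phi/\phi^*$. Moreover, as $k\to\infty$: 1. $\widehat{\widetilde S_0^{(k)}}(\xi)=O(1/k)$ uniformly for $\xi\in\mathbb R$; 2. $\widetilde S_0^{(k)}(t)=O(1)$ uniformly for $t\in\mathbb R$. The implied constants may depend on $n$ and $p$ only. -/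

import Mathlib

open MeasureTheory Filter

noncomputable section

/-- The Fourier transform `ξ ↦ ∫ f(t) e^{-iξt} dt` (angular frequency, no factor in front). -/
def angularFourier (f : ℝ → ℂ) (ξ : ℝ) : ℂ :=
  ∫ t : ℝ, Complex.exp (-(Complex.I * ξ * t)) * f t

/-- The first order spline `e^{a (t - 1)}` on `[0, 1)`, extended by `0`. -/
def truncExp (a : ℝ) : ℝ → ℝ :=
  Set.indicator (Set.Ico 0 1) fun t => Real.exp (a * (t - 1))

/-- The `TB`-spline `Q_N[Λ]` of the unordered vector `Λ = [λ₁, …, λ_N]`, `N ≥ 1`, as the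
convolution of the first order splines of its entries. (There is no spline for the empty vector;
the value there is irrelevant.) Its Fourier transform is computed in `angularFourier_tbSpline`,
which determines it. -/
def tbSpline : List ℝ → ℝ → ℝ
  | [] => 0
  | [a] => truncExp a
  | a :: b :: Λ => fun t => ∫ s : ℝ, truncExp a s * tbSpline (b :: Λ) (t - s)

/-- `φ̂`, the Fourier transform of the scaling function `φ = Q_N[Λ]`. -/
def scalingFourier (Λ : List ℝ) : ℝ → ℂ :=
  angularFourier fun t => (tbSpline Λ t : ℂ)

/-- `φ*(ξ) = ∑_{j ∈ ℤ} φ(j) e^{-iξj}` for `φ = Q_N[Λ]`. -/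
def scalingSymbol (Λ : List ℝ) (ξ : ℝ) : ℂ :=
  ∑' j : ℤ, (tbSpline Λ (j : ℝ) : ℂ) * Complex.exp (-(Complex.I * ξ * j))

/-- The Shannon–Walter exponential spline of `Λ`: the function with Fourier transform `φ̂ / φ*`,
obtained from it by Fourier inversion. -/
def shannonWalter (Λ : List ℝ) (t : ℝ) : ℂ :=
  1 / (2 * Real.pi) *
    ∫ ξ : ℝ, Complex.exp (Complex.I * ξ * t) * (scalingFourier Λ ξ / scalingSymbol Λ ξ)

/-- The vector of order `2p` with entries `k + 2j` and `-n - k + 2 + 2j`, `j = 0, …, p - 1`. -/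
def annulusVector (n p : ℕ) (k : ℝ) : List ℝ :=
  (List.range p).map (fun j : ℕ => k + 2 * (j : ℝ)) ++
    (List.range p).map (fun j : ℕ => -(n : ℝ) - k + 2 + 2 * (j : ℝ))

/-- The vector of order `2p` with `p` entries `-k` and `p` entries `k`. -/
def stripVector (p : ℕ) (k : ℝ) : List ℝ :=
  List.replicate p (-k) ++ List.replicate p k

/-! ### The Fourier transform of the `TB`-spline -/

theorem integrable_truncExp (a : ℝ) : Integrable (truncExp a) := by
  refine IntegrableOn.integrable_indicator ?_ measurableSet_Ico
  refine (Continuous.integrableOn_Icc (a := 0) (b := 1) (by fun_prop)).mono_set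
    Set.Ico_subset_Icc_self

theorem integrable_tbSpline (Λ : List ℝ) : Integrable (tbSpline Λ) := by
  induction Λ with
  | nil => exact integrable_zero _ _ _
  | cons a Λ ih =>
    cases Λ with
    | nil => exact integrable_truncExp a
    | cons b Λ =>
      exact (integrable_truncExp a).integrable_convolution (ContinuousLinearMap.mul ℝ ℝ) ih

theorem angularFourier_truncExp (a ξ : ℝ) (h : Complex.I * ξ - a ≠ 0) :
    angularFourier (fun t => (truncExp a t : ℂ)) ξ
      = (Real.exp (-a) - Complex.exp (-(Complex.I * ξ))) / (Complex.I * ξ - a) := by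
  have h' : (a : ℂ) - Complex.I * ξ ≠ 0 := by
    intro h0; apply h; linear_combination -h0
  have e : (fun t : ℝ => Complex.exp (-(Complex.I * ξ * t)) * (truncExp a t : ℂ))
      = Set.indicator (Set.Ico 0 1)
        fun t : ℝ => Complex.exp (-a) * Complex.exp ((a - Complex.I * ξ) * t) := by
    funext t
    by_cases ht : t ∈ Set.Ico (0 : ℝ) 1
    · simp only [truncExp, Set.indicator_of_mem ht, Complex.ofReal_exp, ← Complex.exp_add]
      congr 1; push_cast; ring
    · simp [truncExp, Set.indicator_of_notMem ht]
  rw [angularFourier, e, integral_indicator measurableSet_Ico, integral_Ico_eq_integral_Ioc,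
    ← intervalIntegral.integral_of_le zero_le_one, intervalIntegral.integral_const_mul,
    integral_exp_mul_complex h', Complex.ofReal_exp]
  have e2 : Complex.exp (-(Complex.I * ξ)) = Complex.exp (-a) * Complex.exp (a - Complex.I * ξ) := by
    rw [← Complex.exp_add]; congr 1; ring
  rw [e2]
  push_cast
  simp only [mul_one, mul_zero, Complex.exp_zero]
  field_simp
  ring

theorem angularFourier_tbSpline_cons (a b : ℝ) (Λ : List ℝ) (ξ : ℝ) :
    angularFourier (fun t => (tbSpline (a :: b :: Λ) t : ℂ)) ξ
      = angularFourier (fun t => (truncExp a t : ℂ)) ξ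
        * angularFourier (fun t => (tbSpline (b :: Λ) t : ℂ)) ξ := by
  have key : ∀ f : ℝ → ℝ, Integrable f →
      Integrable fun t : ℝ => Complex.exp (-(Complex.I * ξ * t)) * (f t : ℂ) := by
    intro f hf
    refine hf.ofReal.bdd_mul (c := 1) (Continuous.aestronglyMeasurable (by fun_prop)) ?_
    refine Eventually.of_forall fun t => ?_
    rw [show -(Complex.I * ξ * t) = ((-(ξ * t) : ℝ) : ℂ) * Complex.I by push_cast; ring,
      Complex.norm_exp_ofReal_mul_I]
  have := integral_convolution (μ := volume) (ν := volume) (ContinuousLinearMap.mul ℝ ℂ)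
    (key _ (integrable_truncExp a)) (key _ (integrable_tbSpline (b :: Λ)))
  rw [ContinuousLinearMap.mul_apply'] at this
  rw [angularFourier, angularFourier, angularFourier, ← this]
  refine integral_congr_ae (Eventually.of_forall fun t => ?_)
  simp only [tbSpline, convolution_def, ContinuousLinearMap.mul_apply']
  rw [← integral_complex_ofReal, ← integral_const_mul]
  refine integral_congr_ae (Eventually.of_forall fun s => ?_)
  have : Complex.exp (-(Complex.I * ξ * t))
      = Complex.exp (-(Complex.I * ξ * s)) * Complex.exp (-(Complex.I * ξ * (t - s : ℝ))) := by
    rw [← Complex.exp_add]; congr 1; push_cast; ring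
  simp only [this]
  push_cast
  ring

/-- `Q̂_N(ξ) = ∏ (e^{-λ_j} - e^{-iξ}) / (iξ - λ_j)`. -/
theorem angularFourier_tbSpline (Λ : List ℝ) (hΛ : Λ ≠ []) (ξ : ℝ)
    (h : ∀ a ∈ Λ, Complex.I * ξ - a ≠ 0) :
    angularFourier (fun t => (tbSpline Λ t : ℂ)) ξ
      = (Λ.map fun a : ℝ => ((Real.exp (-a) : ℂ) - Complex.exp (-(Complex.I * ξ)))
          / (Complex.I * ξ - a)).prod := by
  induction Λ with
  | nil => exact absurd rfl hΛ
  | cons a Λ ih =>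
    cases Λ with
    | nil =>
      simp only [tbSpline, List.map_cons, List.map_nil, List.prod_cons, List.prod_nil, mul_one]
      exact angularFourier_truncExp a ξ (h a (by simp))
    | cons b Λ =>
      rw [angularFourier_tbSpline_cons, ih (by simp) fun c hc => h c (by simp [hc]),
        angularFourier_truncExp a ξ (h a (by simp))]
      simp

end

noncomputable section

/-! ### Regularity and support of the `TB`-spline -/

/-! Poisson summation gives `φ*(ξ) = ∑ φ̂(ξ + 2πm)`. The numerator of `φ̂` is `2π`-periodic and has
no zero because no entry vanishes, so it cancels: `φ̂/φ* = R(ξ) / ∑ R(ξ + 2πm)` with `R = ∏ 1/(iξ -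
λ_j)` (`summable_and_scalingSymbol_eq_mul`).

In both families the entries pair up as `k + O(1)` and `-k + O(1)`, so `(-1)^p (ξ² + k²)^p R(ξ)`
tends to `1` uniformly in `ξ` (`eventually_nearPower`). Hence `|R|` is at most a multiple of `(ξ² +
k²)^{-p}`, and the terms of the periodization, up to the common sign, have positive real parts and
cannot cancel. About `k` of the points `ξ + 2πm` have size `O(k)`, so the sum is at least a multiple
of `k · k^{-2p}` (`NearPower.le_norm_tsum`).

The quotient is therefore at most `C k / (ξ² + k²)` (`NearPower.norm_div_le`). The supremum of this
bound is `C/k` and its integral is `Cπ`, which yields both estimates. Inversion is legitimate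
because the quotient and its first two derivatives are `O((1 + |ξ|)^{-2})`. -/

open Topology in
theorem continuousAt_truncExp (a : ℝ) {t : ℝ} (ht : t ∉ ({0, 1} : Set ℝ)) :
    ContinuousAt (truncExp a) t := by
  simp only [Set.mem_insert_iff, Set.mem_singleton_iff, not_or] at ht
  obtain ⟨h0, h1⟩ := ht
  have hfr : t ∉ frontier (Set.Ico (0 : ℝ) 1) := by
    simp [frontier_Ico, h0, h1]
  have hc : Continuous fun t : ℝ => Real.exp (a * (t - 1)) := by fun_prop
  rw [frontier, Set.mem_sdiff, not_and_or, not_not] at hfr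
  rcases hfr with h | h
  · have : (Set.Ico (0 : ℝ) 1)ᶜ ∈ 𝓝 t :=
      mem_of_superset (isClosed_closure.isOpen_compl.mem_nhds h)
        (Set.compl_subset_compl.2 subset_closure)
    refine (continuousAt_const (y := (0 : ℝ))).congr ?_
    filter_upwards [this] with s hs
    rw [truncExp, Set.indicator_of_notMem hs]
  · refine hc.continuousAt.congr ?_
    filter_upwards [mem_interior_iff_mem_nhds.1 h] with s hs
    rw [truncExp, Set.indicator_of_mem hs]

theorem abs_truncExp_le (a t : ℝ) : |truncExp a t| ≤ Real.exp |a| := by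
  by_cases ht : t ∈ Set.Ico (0 : ℝ) 1
  · rw [truncExp, Set.indicator_of_mem ht, Real.abs_exp]
    refine Real.exp_le_exp.2 ((le_abs_self _).trans ?_)
    rw [abs_mul]
    refine mul_le_of_le_one_right (abs_nonneg a) (abs_le.2 ⟨?_, ?_⟩) <;> linarith [ht.1, ht.2]
  · rw [truncExp, Set.indicator_of_notMem ht, abs_zero]
    positivity

/-- Convolving with a first order spline smooths out discontinuities at `0` and `1`. -/
theorem continuous_integral_truncExp_mul (a : ℝ) {f : ℝ → ℝ} (hf : Integrable f) {C : ℝ}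
    (hC : ∀ t, |f t| ≤ C) (hcont : ∀ t ∉ ({0, 1} : Set ℝ), ContinuousAt f t) :
    Continuous fun t : ℝ => ∫ s : ℝ, truncExp a s * f (t - s) := by
  refine continuous_iff_continuousAt.2 fun t => ?_
  refine continuousAt_of_dominated (bound := fun s => |truncExp a s| * C) ?_ ?_ ?_ ?_
  · exact Eventually.of_forall fun x =>
      (integrable_truncExp a).aestronglyMeasurable.mul (hf.comp_sub_left x).aestronglyMeasurable
  · refine Eventually.of_forall fun x => Eventually.of_forall fun s => ?_
    rw [Real.norm_eq_abs, abs_mul]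
    exact mul_le_mul_of_nonneg_left (hC _) (abs_nonneg _)
  · exact (integrable_truncExp a).abs.mul_const C
  · have : ∀ᵐ s : ℝ, s ∉ ({t, t - 1} : Set ℝ) :=
      (Set.to_countable ({t, t - 1} : Set ℝ)).ae_notMem volume
    filter_upwards [this] with s hs
    have hts : t - s ∉ ({0, 1} : Set ℝ) := by
      simp only [Set.mem_insert_iff, Set.mem_singleton_iff, not_or] at hs ⊢
      exact ⟨fun h => hs.1 (by linarith), fun h => hs.2 (by linarith)⟩
    exact continuousAt_const.mul
      (ContinuousAt.comp (f := fun x : ℝ => x - s) (hcont _ hts) (by fun_prop))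

/-- The exceptional points `0` and `1` matter only for order one. Boundedness supplies the
domination needed to convolve once more. -/
theorem tbSpline_bounded_and_continuousAt (Λ : List ℝ) :
    (∃ C, ∀ t, |tbSpline Λ t| ≤ C) ∧
      ∀ t ∉ ({0, 1} : Set ℝ), ContinuousAt (tbSpline Λ) t := by
  induction Λ with
  | nil => exact ⟨⟨0, fun t => by simp [tbSpline]⟩, fun t _ => continuousAt_const⟩
  | cons a Λ ih =>
    cases Λ with
    | nil => exact ⟨⟨_, abs_truncExp_le a⟩, fun t ht => continuousAt_truncExp a ht⟩
    | cons b Λ =>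
      obtain ⟨⟨C, hC⟩, hcont⟩ := ih
      refine ⟨⟨∫ s, |truncExp a s| * C, fun t => ?_⟩, fun t _ =>
        (continuous_integral_truncExp_mul a (integrable_tbSpline _) hC hcont).continuousAt⟩
      refine norm_integral_le_of_norm_le (f := fun s => truncExp a s * tbSpline (b :: Λ) (t - s))
        ((integrable_truncExp a).abs.mul_const C) (Eventually.of_forall fun s => ?_)
      rw [Real.norm_eq_abs, abs_mul]
      exact mul_le_mul_of_nonneg_left (hC _) (abs_nonneg _)

theorem continuous_tbSpline {Λ : List ℝ} (hΛ : 2 ≤ Λ.length) : Continuous (tbSpline Λ) := by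
  match Λ, hΛ with
  | a :: b :: Λ, _ =>
    obtain ⟨⟨C, hC⟩, hcont⟩ := tbSpline_bounded_and_continuousAt (b :: Λ)
    exact continuous_integral_truncExp_mul a (integrable_tbSpline _) hC hcont

theorem tbSpline_eq_zero (Λ : List ℝ) {t : ℝ} (ht : t ∉ Set.Icc (0 : ℝ) Λ.length) :
    tbSpline Λ t = 0 := by
  induction Λ generalizing t with
  | nil => rfl
  | cons a Λ ih =>
    cases Λ with
    | nil =>
      have h' : t ∉ Set.Ico (0 : ℝ) 1 := fun h => ht ⟨h.1, by simpa using h.2.le⟩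
      rw [tbSpline, truncExp, Set.indicator_of_notMem h']
    | cons b Λ =>
      have : ∀ s, truncExp a s * tbSpline (b :: Λ) (t - s) = 0 := by
        intro s
        by_cases hs : s ∈ Set.Ico (0 : ℝ) 1
        · rw [ih, mul_zero]
          rintro ⟨h0, h1⟩
          refine ht ⟨by linarith [hs.1], ?_⟩
          rw [List.length_cons, Nat.cast_succ]
          linarith [hs.2]
        · rw [truncExp, Set.indicator_of_notMem hs, zero_mul]
      simp only [tbSpline, this, integral_zero]

theorem tbSpline_intCast_eq_zero (Λ : List ℝ) {j : ℤ}
    (hj : j ∉ Finset.Icc (0 : ℤ) Λ.length) : tbSpline Λ j = 0 := by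
  refine tbSpline_eq_zero Λ fun h => hj ?_
  rw [Finset.mem_Icc]
  exact ⟨by exact_mod_cast h.1, by exact_mod_cast h.2⟩

theorem scalingSymbol_eq_sum (Λ : List ℝ) (ξ : ℝ) :
    scalingSymbol Λ ξ = ∑ j ∈ Finset.Icc (0 : ℤ) Λ.length,
      (tbSpline Λ (j : ℝ) : ℂ) * Complex.exp (-(Complex.I * ξ * j)) :=
  tsum_eq_sum fun j hj => by rw [tbSpline_intCast_eq_zero Λ hj]; simp

/-! ### The two factors of the Fourier transform -/

/-- The `2π`-periodic numerator `∏ (e^{-λ_j} - e^{-iξ})` of `φ̂`. -/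
def scalingNumerator (Λ : List ℝ) (ξ : ℝ) : ℂ :=
  (Λ.map fun a : ℝ => (Real.exp (-a) : ℂ) - Complex.exp (-(Complex.I * ξ))).prod

/-- The reciprocal `∏ 1 / (iξ - λ_j)` of the characteristic polynomial on the imaginary axis. -/
def charReciprocal (Λ : List ℝ) (ξ : ℝ) : ℂ :=
  (Λ.map fun a : ℝ => (Complex.I * ξ - a)⁻¹).prod

theorem I_mul_ofReal_sub_ne_zero {a : ℝ} (ha : a ≠ 0) (ξ : ℝ) : Complex.I * ξ - a ≠ 0 := by
  intro h
  have := congrArg Complex.re h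
  simp [ha] at this

theorem scalingFourier_eq_mul {Λ : List ℝ} (hΛ : Λ ≠ []) (h0 : ∀ a ∈ Λ, a ≠ 0) (ξ : ℝ) :
    scalingFourier Λ ξ = scalingNumerator Λ ξ * charReciprocal Λ ξ := by
  rw [scalingFourier, angularFourier_tbSpline Λ hΛ ξ fun a ha =>
    I_mul_ofReal_sub_ne_zero (h0 a ha) ξ, scalingNumerator, charReciprocal, ← List.prod_map_mul]
  simp only [div_eq_mul_inv]

theorem scalingNumerator_add_int (Λ : List ℝ) (ξ : ℝ) (m : ℤ) :
    scalingNumerator Λ (ξ + 2 * Real.pi * m) = scalingNumerator Λ ξ := by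
  have : Complex.exp (-(Complex.I * (ξ + 2 * Real.pi * m : ℝ))) =
      Complex.exp (-(Complex.I * ξ)) := by
    refine Complex.exp_eq_exp_iff_exists_int.2 ⟨-m, ?_⟩
    push_cast
    ring
  simp only [scalingNumerator, this]

/-- Distance from `0` of the numerator of `φ̂`. -/
theorem exists_le_norm_scalingNumerator {Λ : List ℝ} (h0 : ∀ a ∈ Λ, a ≠ 0) :
    ∃ c > 0, ∀ ξ, c ≤ ‖scalingNumerator Λ ξ‖ := by
  induction Λ with
  | nil => exact ⟨1, one_pos, fun ξ => by simp [scalingNumerator]⟩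
  | cons a Λ ih =>
    obtain ⟨c, hc, h⟩ := ih fun b hb => h0 b (by simp [hb])
    have ha : Real.exp (-a) ≠ 1 := by simpa using h0 a (by simp)
    have ha' : 0 < |Real.exp (-a) - 1| := abs_pos.2 (sub_ne_zero.2 ha)
    refine ⟨|Real.exp (-a) - 1| * c, mul_pos ha' hc, fun ξ => ?_⟩
    rw [scalingNumerator, List.map_cons, List.prod_cons, norm_mul]
    refine mul_le_mul ?_ (h ξ) hc.le (norm_nonneg _)
    have hn : ‖Complex.exp (-(Complex.I * ξ))‖ = 1 := by
      rw [show -(Complex.I * ξ) = ((-ξ : ℝ) : ℂ) * Complex.I by push_cast; ring,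
        Complex.norm_exp_ofReal_mul_I]
    have := abs_norm_sub_norm_le (Real.exp (-a) : ℂ) (Complex.exp (-(Complex.I * ξ)))
    rwa [hn, Complex.norm_real, Real.norm_eq_abs, Real.abs_exp] at this

/-! ### Twice differentiable functions with decaying derivatives -/

/-- `f` is twice continuously differentiable, and `f`, `f'`, `f''` are `O((1 + |x|)^{-s})`. -/
def HasDecayingDerivs (f : ℝ → ℂ) (s : ℕ) : Prop :=
  ∃ (f₁ f₂ : ℝ → ℂ) (C : ℝ), (∀ x, HasDerivAt f (f₁ x) x) ∧ (∀ x, HasDerivAt f₁ (f₂ x) x) ∧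
    Continuous f₂ ∧ 0 ≤ C ∧ ∀ x, ‖f x‖ ≤ C * ((1 + |x|)⁻¹) ^ s ∧
      ‖f₁ x‖ ≤ C * ((1 + |x|)⁻¹) ^ s ∧ ‖f₂ x‖ ≤ C * ((1 + |x|)⁻¹) ^ s

namespace HasDecayingDerivs

variable {f g : ℝ → ℂ} {s t : ℕ}

theorem congr (hf : HasDecayingDerivs f s) (h : ∀ x, g x = f x) : HasDecayingDerivs g s := by
  rwa [show g = f from funext h]

theorem mul (hf : HasDecayingDerivs f s) (hg : HasDecayingDerivs g t) :
    HasDecayingDerivs (fun x => f x * g x) (s + t) := by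
  obtain ⟨f₁, f₂, C, hf₁, hf₂, hfc, hC, hfb⟩ := hf
  obtain ⟨g₁, g₂, D, hg₁, hg₂, hgc, hD, hgb⟩ := hg
  have hc : ∀ {u u' : ℝ → ℂ}, (∀ x, HasDerivAt u (u' x) x) → Continuous u := fun h =>
    continuous_iff_continuousAt.2 fun x => (h x).continuousAt
  have key : ∀ {x : ℝ} {z w : ℂ}, ‖z‖ ≤ C * ((1 + |x|)⁻¹) ^ s → ‖w‖ ≤ D * ((1 + |x|)⁻¹) ^ t →
      ‖z * w‖ ≤ C * D * ((1 + |x|)⁻¹) ^ (s + t) := by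
    intro x z w hz hw
    rw [norm_mul, pow_add, mul_mul_mul_comm]
    exact mul_le_mul hz hw (norm_nonneg _) (by positivity)
  refine ⟨fun x => f₁ x * g x + f x * g₁ x,
    fun x => f₂ x * g x + f₁ x * g₁ x + (f₁ x * g₁ x + f x * g₂ x), 4 * (C * D),
    fun x => (hf₁ x).mul (hg₁ x), fun x => ((hf₂ x).mul (hg₁ x)).add ((hf₁ x).mul (hg₂ x)),
    ?_, by positivity, fun x => ?_⟩
  · have := hc hf₁; have := hc hf₂; have := hc hg₁; have := hc hg₂
    fun_prop
  · obtain ⟨a0, a1, a2⟩ := hfb x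
    obtain ⟨b0, b1, b2⟩ := hgb x
    have h00 := key a0 b0
    have h01 := key a0 b1
    have h10 := key a1 b0
    have h11 := key a1 b1
    have h02 := key a0 b2
    have h20 := key a2 b0
    have hp : 0 ≤ C * D * ((1 + |x|)⁻¹) ^ (s + t) := by positivity
    refine ⟨by linarith, ?_, ?_⟩
    · linarith [norm_add_le (f₁ x * g x) (f x * g₁ x)]
    · linarith [norm_add_le (f₂ x * g x + f₁ x * g₁ x) (f₁ x * g₁ x + f x * g₂ x),
        norm_add_le (f₂ x * g x) (f₁ x * g₁ x), norm_add_le (f₁ x * g₁ x) (f x * g₂ x)]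

theorem add (hf : HasDecayingDerivs f s) (hg : HasDecayingDerivs g s) :
    HasDecayingDerivs (fun x => f x + g x) s := by
  obtain ⟨f₁, f₂, C, hf₁, hf₂, hfc, hC, hfb⟩ := hf
  obtain ⟨g₁, g₂, D, hg₁, hg₂, hgc, hD, hgb⟩ := hg
  refine ⟨fun x => f₁ x + g₁ x, fun x => f₂ x + g₂ x, C + D, fun x => (hf₁ x).add (hg₁ x),
    fun x => (hf₂ x).add (hg₂ x), hfc.add hgc, add_nonneg hC hD, fun x => ?_⟩
  obtain ⟨a0, a1, a2⟩ := hfb x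
  obtain ⟨b0, b1, b2⟩ := hgb x
  simp only [add_mul]
  exact ⟨norm_add_le_of_le a0 b0, norm_add_le_of_le a1 b1, norm_add_le_of_le a2 b2⟩

theorem mono (hf : HasDecayingDerivs f s) (h : t ≤ s) : HasDecayingDerivs f t := by
  obtain ⟨f₁, f₂, C, hf₁, hf₂, hfc, hC, hfb⟩ := hf
  refine ⟨f₁, f₂, C, hf₁, hf₂, hfc, hC, fun x => ?_⟩
  have : C * ((1 + |x|)⁻¹) ^ s ≤ C * ((1 + |x|)⁻¹) ^ t :=
    mul_le_mul_of_nonneg_left (pow_le_pow_of_le_one (by positivity)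
      (inv_le_one_of_one_le₀ (by linarith [abs_nonneg x])) h) hC
  exact ⟨(hfb x).1.trans this, (hfb x).2.1.trans this, (hfb x).2.2.trans this⟩

theorem const (c : ℂ) : HasDecayingDerivs (fun _ => c) 0 :=
  ⟨fun _ => 0, fun _ => 0, ‖c‖, fun x => hasDerivAt_const x c, fun x => hasDerivAt_const x 0,
    continuous_const, norm_nonneg c, fun x => by simp⟩

theorem cexp (c : ℝ) : HasDecayingDerivs (fun x : ℝ => Complex.exp (-(Complex.I * x * c))) 0 := by
  have hd : ∀ x : ℝ, HasDerivAt (fun x : ℝ => Complex.exp (-(Complex.I * x * c)))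
      (-(Complex.I * c) * Complex.exp (-(Complex.I * x * c))) x := by
    intro x
    have := (((Complex.ofRealCLM.hasDerivAt (x := x)).const_mul Complex.I).mul_const
      (c : ℂ)).neg.cexp
    simp only [Complex.ofRealCLM_apply, Complex.ofReal_one, mul_one] at this
    rwa [mul_comm]
  have hn : ∀ x : ℝ, ‖Complex.exp (-(Complex.I * x * c))‖ = 1 := by
    intro x
    rw [show -(Complex.I * x * c) = ((-(x * c) : ℝ) : ℂ) * Complex.I by push_cast; ring,
      Complex.norm_exp_ofReal_mul_I]
  refine ⟨_, _, 1 + |c| + |c| * |c|, hd, fun x => (hd x).const_mul (-(Complex.I * c)),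
    by fun_prop, by positivity, fun x => ?_⟩
  have h2 : 0 ≤ |c| * |c| := by positivity
  have h1 := abs_nonneg c
  simp only [norm_mul, norm_neg, Complex.norm_I, Complex.norm_real, Real.norm_eq_abs, hn,
    pow_zero, mul_one, one_mul]
  exact ⟨by linarith, by linarith, by linarith⟩

theorem inv {f : ℝ → ℂ} (hf : HasDecayingDerivs f 0) {δ : ℝ} (hδ : 0 < δ)
    (h : ∀ x, δ ≤ ‖f x‖) : HasDecayingDerivs (fun x => (f x)⁻¹) 0 := by
  obtain ⟨f₁, f₂, C, hf₁, hf₂, hfc, hC, hfb⟩ := hf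
  have h0 : ∀ x, f x ≠ 0 := fun x => norm_pos_iff.1 (hδ.trans_le (h x))
  have hc : ∀ {u u' : ℝ → ℂ}, (∀ x, HasDerivAt u (u' x) x) → Continuous u := fun h =>
    continuous_iff_continuousAt.2 fun x => (h x).continuousAt
  have hd : ∀ x, HasDerivAt (fun x => (f x)⁻¹) (-f₁ x * ((f x)⁻¹ * (f x)⁻¹)) x := by
    intro x
    refine ((hf₁ x).inv (h0 x)).congr_deriv ?_
    rw [div_eq_mul_inv, pow_two, mul_inv]
  have hd2 := fun x => (hf₂ x).neg.mul ((hd x).mul (hd x))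
  have hi : ∀ x, ‖(f x)⁻¹‖ ≤ δ⁻¹ := fun x => by
    rw [norm_inv]; exact inv_anti₀ hδ (h x)
  simp only [pow_zero, mul_one] at hfb
  refine ⟨_, _, δ⁻¹ + C * (δ⁻¹ * δ⁻¹) + (C * (δ⁻¹ * δ⁻¹) +
    C * ((C * (δ⁻¹ * δ⁻¹)) * δ⁻¹ + δ⁻¹ * (C * (δ⁻¹ * δ⁻¹)))), hd, hd2, ?_, by positivity,
    fun x => ?_⟩
  · have := hc hf₁; have := hc hf₂; have := (hc hf₁).inv₀ h0
    simp only [Pi.neg_apply]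
    fun_prop
  · have h1 : ‖-f₁ x * ((f x)⁻¹ * (f x)⁻¹)‖ ≤ C * (δ⁻¹ * δ⁻¹) := by
      rw [norm_mul, norm_neg, norm_mul]
      have := hi x
      have := (hfb x).2.1
      gcongr
    have h2 : ‖-f₂ x * ((f x)⁻¹ * (f x)⁻¹)‖ ≤ C * (δ⁻¹ * δ⁻¹) := by
      rw [norm_mul, norm_neg, norm_mul]
      have := hi x
      have := (hfb x).2.2
      gcongr
    have h3 : ‖-f₁ x * (-f₁ x * ((f x)⁻¹ * (f x)⁻¹) * (f x)⁻¹ +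
        (f x)⁻¹ * (-f₁ x * ((f x)⁻¹ * (f x)⁻¹)))‖ ≤
        C * ((C * (δ⁻¹ * δ⁻¹)) * δ⁻¹ + δ⁻¹ * (C * (δ⁻¹ * δ⁻¹))) := by
      rw [norm_mul, norm_neg]
      refine mul_le_mul (hfb x).2.1 (norm_add_le_of_le ?_ ?_) (norm_nonneg _) hC
      · rw [norm_mul]; exact mul_le_mul h1 (hi x) (norm_nonneg _) (by positivity)
      · rw [norm_mul]; exact mul_le_mul (hi x) h1 (norm_nonneg _) (by positivity)
    have p1 : 0 ≤ δ⁻¹ := by positivity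
    have p2 : 0 ≤ C * (δ⁻¹ * δ⁻¹) := by positivity
    have p3 : 0 ≤ C * ((C * (δ⁻¹ * δ⁻¹)) * δ⁻¹ + δ⁻¹ * (C * (δ⁻¹ * δ⁻¹))) := by positivity
    simp only [pow_zero, mul_one]
    refine ⟨by linarith [hi x], by linarith, ?_⟩
    refine (norm_add_le_of_le h2 h3).trans ?_
    linarith

/-- Since `f' = -i f²`, all derivatives are polynomials in `f` without constant term and inherit its
decay. -/
theorem inv_I_mul_sub {a : ℝ} (ha : a ≠ 0) :
    HasDecayingDerivs (fun x : ℝ => (Complex.I * x - a)⁻¹) 1 := by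
  have h0 := I_mul_ofReal_sub_ne_zero ha
  set f : ℝ → ℂ := fun x => (Complex.I * x - a)⁻¹ with hf
  have hd : ∀ x, HasDerivAt f (-Complex.I * (f x * f x)) x := by
    intro x
    have := (((Complex.ofRealCLM.hasDerivAt (x := x)).const_mul Complex.I).sub_const
      (a : ℂ)).inv (h0 x)
    simp only [Complex.ofRealCLM_apply, Complex.ofReal_one, mul_one] at this
    refine this.congr_deriv ?_
    rw [hf, div_eq_mul_inv, pow_two, mul_inv]
  have hcont : Continuous f := continuous_iff_continuousAt.2 fun x => (hd x).continuousAt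
  -- Both `|x|` and `|a|` are at most `‖ix - a‖`, so `1 + |x| ≤ D ‖ix - a‖`.
  set D : ℝ := 1 + |a|⁻¹ with hD
  have ha' : 0 < |a| := abs_pos.2 ha
  have hD1 : 1 ≤ D := by rw [hD]; linarith [inv_pos.2 ha']
  have hb : ∀ x : ℝ, ‖f x‖ ≤ D * (1 + |x|)⁻¹ := by
    intro x
    have e1 : |x| ≤ ‖Complex.I * x - a‖ := by
      simpa using Complex.abs_im_le_norm (Complex.I * x - a)
    have e2 : |a| ≤ ‖Complex.I * x - a‖ := by
      simpa using Complex.abs_re_le_norm (Complex.I * x - a)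
    have hpos : 0 < ‖Complex.I * x - a‖ := ha'.trans_le e2
    rw [hf, norm_inv, ← div_eq_mul_inv, inv_eq_one_div, div_le_div_iff₀ hpos (by positivity), hD,
      add_mul]
    have : 1 ≤ |a|⁻¹ * ‖Complex.I * x - a‖ := by
      rw [inv_mul_eq_div, le_div_iff₀ ha']; linarith
    linarith
  have hw : ∀ x : ℝ, (1 + |x|)⁻¹ ≤ 1 := fun x => inv_le_one_of_one_le₀ (by linarith [abs_nonneg x])
  have hb1 : ∀ x, ‖f x‖ ≤ D := fun x =>
    (hb x).trans (mul_le_of_le_one_right (by linarith) (hw x))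
  refine ⟨_, _, D + D * D + 2 * (D * D * D), hd,
    fun x => ((hd x).mul (hd x)).const_mul (-Complex.I), by fun_prop, by positivity, fun x => ?_⟩
  have hw0 : 0 ≤ (1 + |x|)⁻¹ := by positivity
  have q1 : ‖f x * f x‖ ≤ D * D * (1 + |x|)⁻¹ := by
    rw [norm_mul, mul_assoc]
    exact mul_le_mul (hb1 x) (hb x) (norm_nonneg _) (by positivity)
  have q1' : ‖-Complex.I * (f x * f x)‖ ≤ D * D * (1 + |x|)⁻¹ := by simpa using q1
  have q2 : ‖-Complex.I * (f x * f x) * f x‖ ≤ D * D * D * (1 + |x|)⁻¹ := by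
    rw [norm_mul]
    refine (mul_le_mul q1' (hb1 x) (norm_nonneg _) (by positivity)).trans_eq (by ring)
  have q3 : ‖f x * (-Complex.I * (f x * f x))‖ ≤ D * D * D * (1 + |x|)⁻¹ := by
    rwa [mul_comm]
  have p1 : 0 ≤ D * (1 + |x|)⁻¹ := by positivity
  have p2 : 0 ≤ D * D * (1 + |x|)⁻¹ := by positivity
  have p3 : 0 ≤ D * D * D * (1 + |x|)⁻¹ := by positivity
  simp only [pow_one, add_mul]
  refine ⟨by linarith [hb x], by linarith, ?_⟩
  rw [norm_mul, norm_neg, Complex.norm_I, one_mul]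
  refine (norm_add_le_of_le q2 q3).trans ?_
  linarith

theorem list_prod {ι : Type*} (l : List ι) (F : ι → ℝ → ℂ)
    (h : ∀ i ∈ l, HasDecayingDerivs (F i) 1) :
    HasDecayingDerivs (fun x => (l.map fun i => F i x).prod) l.length := by
  induction l with
  | nil => simpa using const 1
  | cons i l ih =>
    have := (h i (by simp)).mul (ih fun j hj => h j (by simp [hj]))
    rw [add_comm] at this
    simpa using this

theorem finset_sum {ι : Type*} (u : Finset ι) (F : ι → ℝ → ℂ)
    (h : ∀ i ∈ u, HasDecayingDerivs (F i) 0) :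
    HasDecayingDerivs (fun x => ∑ i ∈ u, F i x) 0 := by
  classical
  induction u using Finset.induction_on with
  | empty => simpa using const 0
  | insert i u hi ih =>
    simpa [Finset.sum_insert hi] using
      (h i (by simp)).add (ih fun j hj => h j (by simp [hj]))

theorem continuous (hf : HasDecayingDerivs f s) : Continuous f := by
  obtain ⟨f₁, f₂, C, hf₁, -⟩ := hf
  exact continuous_iff_continuousAt.2 fun x => (hf₁ x).continuousAt

theorem inv_one_add_abs_sq_le (x : ℝ) : ((1 + |x|)⁻¹) ^ 2 ≤ (1 + x ^ 2)⁻¹ := by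
  rw [inv_pow]
  refine inv_anti₀ (by positivity) ?_
  nlinarith [abs_nonneg x, sq_abs x]

theorem integrable_of_bound {f : ℝ → ℂ} (hf : Continuous f) {C : ℝ} (hC : 0 ≤ C)
    (h : ∀ x, ‖f x‖ ≤ C * ((1 + |x|)⁻¹) ^ 2) : Integrable f :=
  (integrable_inv_one_add_sq.const_mul C).mono' hf.aestronglyMeasurable
    (Eventually.of_forall fun x =>
      (h x).trans (mul_le_mul_of_nonneg_left (inv_one_add_abs_sq_le x) hC))

theorem integrable (hf : HasDecayingDerivs f 2) : Integrable f := by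
  have hc := hf.continuous
  obtain ⟨f₁, f₂, C, hf₁, hf₂, hfc, hC, hfb⟩ := hf
  exact integrable_of_bound hc hC fun x => (hfb x).1

-- Two derivatives suffice: `(2πx)² |𝓕 f(x)| ≤ ‖f''‖₁` together with `|𝓕 f(x)| ≤ ‖f‖₁` bounds `𝓕 f`
-- by a multiple of `1/(1 + x²)`.
open FourierTransform in
theorem integrable_fourier (hf : HasDecayingDerivs f 2) : Integrable (𝓕 f) := by
  have hfi := hf.integrable
  obtain ⟨f₁, f₂, C, hf₁, hf₂, hfc, hC, hfb⟩ := hf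
  have hc₁ : Continuous f₁ := continuous_iff_continuousAt.2 fun x => (hf₂ x).continuousAt
  have hi₁ : Integrable f₁ := integrable_of_bound hc₁ hC fun x => (hfb x).2.1
  have hi₂ : Integrable f₂ := integrable_of_bound hfc hC fun x => (hfb x).2.2
  have d₁ : deriv f = f₁ := funext fun x => (hf₁ x).deriv
  have d₂ : deriv f₁ = f₂ := funext fun x => (hf₂ x).deriv
  have F₁ := Real.fourier_deriv hfi (fun x => (hf₁ x).differentiableAt) (d₁ ▸ hi₁)
  have F₂ := Real.fourier_deriv hi₁ (fun x => (hf₂ x).differentiableAt) (d₂ ▸ hi₂)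
  rw [d₁] at F₁
  rw [d₂, F₁] at F₂
  have hcF : Continuous (𝓕 f) :=
    VectorFourier.fourierIntegral_continuous Real.continuous_fourierChar
      (innerSL ℝ).continuous₂ hfi
  have hle : ∀ (u : ℝ → ℂ) (x : ℝ), ‖𝓕 u x‖ ≤ ∫ v, ‖u v‖ := fun u x =>
    VectorFourier.norm_fourierIntegral_le_integral_norm _ _ _ u x
  refine (integrable_inv_one_add_sq.const_mul ((∫ v, ‖f v‖) + ∫ v, ‖f₂ v‖)).mono'
    hcF.aestronglyMeasurable (Eventually.of_forall fun x => ?_)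
  rw [← div_eq_mul_inv, le_div_iff₀ (by positivity), mul_add, mul_one]
  refine add_le_add (hle f x) ?_
  have h2 := hle f₂ x
  rw [F₂] at h2
  simp only [smul_eq_mul, norm_mul, Complex.norm_I, Complex.norm_real, Real.norm_eq_abs,
    Complex.norm_ofNat, mul_one] at h2
  refine le_trans ?_ h2
  have hpi : 1 ≤ 2 * |Real.pi| := by
    rw [abs_of_pos Real.pi_pos]; linarith [Real.pi_gt_three]
  have e : 2 * |Real.pi| * |x| * (2 * |Real.pi| * |x| * ‖𝓕 f x‖) =
      (2 * |Real.pi|) ^ 2 * (‖𝓕 f x‖ * x ^ 2) := by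
    rw [← sq_abs x]; ring
  rw [e]
  exact le_mul_of_one_le_left (by positivity) (one_le_pow₀ hpi)

end HasDecayingDerivs

theorem hasDecayingDerivs_scalingSymbol (Λ : List ℝ) : HasDecayingDerivs (scalingSymbol Λ) 0 := by
  refine (HasDecayingDerivs.finset_sum (Finset.Icc (0 : ℤ) Λ.length)
    (fun j ξ => (tbSpline Λ (j : ℝ) : ℂ) * Complex.exp (-(Complex.I * ξ * j))) fun j _ => ?_).congr
    (scalingSymbol_eq_sum Λ)
  have := HasDecayingDerivs.cexp j
  simp only [Complex.ofReal_intCast] at this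
  exact (HasDecayingDerivs.const _).mul this

theorem hasDecayingDerivs_scalingFourier {Λ : List ℝ} (hΛ : Λ ≠ []) (h0 : ∀ a ∈ Λ, a ≠ 0) :
    HasDecayingDerivs (scalingFourier Λ) Λ.length := by
  refine (HasDecayingDerivs.list_prod Λ (fun a ξ => ((Real.exp (-a) : ℂ) +
    -1 * Complex.exp (-(Complex.I * ξ * (1 : ℝ)))) * (Complex.I * ξ - a)⁻¹) fun a ha => ?_).congr
    fun ξ => ?_
  · have := ((HasDecayingDerivs.const (Real.exp (-a) : ℂ)).add ((HasDecayingDerivs.const (-1)).mul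
      (HasDecayingDerivs.cexp 1))).mul (HasDecayingDerivs.inv_I_mul_sub (h0 a ha))
    exact this
  · rw [scalingFourier_eq_mul hΛ h0, scalingNumerator, charReciprocal, ← List.prod_map_mul]
    simp [sub_eq_add_neg]

/-! ### Fourier inversion for the angular Fourier transform -/

-- `S` is `𝓕 g` rescaled by `-1/(2π)`, so the claim is Fourier inversion for `g` after a change of
-- variables.
open FourierTransform in
theorem integrable_and_angularFourier_inverse {g S : ℝ → ℂ} (hg : HasDecayingDerivs g 2)
    (hS : ∀ t, S t = 1 / (2 * Real.pi) * ∫ ξ : ℝ, Complex.exp (Complex.I * ξ * t) * g ξ) :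
    Integrable S ∧ ∀ ξ, angularFourier S ξ = g ξ := by
  have hpi : -(2 * Real.pi) ≠ 0 := by simp [Real.pi_ne_zero]
  have hpi' : (Real.pi : ℂ) ≠ 0 := by exact_mod_cast Real.pi_ne_zero
  have hS' : S = fun t => 1 / (2 * Real.pi) * 𝓕 g (t / -(2 * Real.pi)) := by
    funext t
    rw [hS, Real.fourier_real_eq_integral_exp_smul]
    congr 2
    funext ξ
    rw [smul_eq_mul]
    congr 2
    push_cast
    field_simp
  have hF := hg.integrable_fourier
  refine ⟨hS' ▸ (hF.comp_div hpi).const_mul _, fun ξ => ?_⟩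
  have hinv := congrFun (hg.continuous.fourierInv_fourier_eq hg.integrable hF) ξ
  rw [Real.fourierInv_eq_fourier_neg, Real.fourier_real_eq_integral_exp_smul] at hinv
  obtain ⟨G, hG⟩ : ∃ G : ℝ → ℂ, ∀ u : ℝ,
    Complex.exp ((-2 * Real.pi * u * -ξ : ℝ) * Complex.I) • 𝓕 g u = G u := ⟨_, fun _ => rfl⟩
  simp only [hG] at hinv
  have e : ∀ t : ℝ, Complex.exp (-(Complex.I * ξ * t)) *
      (1 / (2 * Real.pi) * 𝓕 g (t / -(2 * Real.pi))) =
        (1 / (2 * Real.pi) : ℂ) * G (t / -(2 * Real.pi)) := by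
    intro t
    rw [← hG, smul_eq_mul, mul_left_comm]
    congr 3
    push_cast
    field_simp
  simp only [angularFourier, hS', e]
  rw [← hinv, integral_const_mul, Measure.integral_comp_div G, abs_neg,
    abs_of_pos (by have := Real.pi_pos; positivity), Complex.real_smul, ← mul_assoc]
  push_cast
  field_simp

/-! ### Poisson summation for the symbol -/

-- Poisson summation at `0` for `φ(t) e^{-iξt}`: the modulation shifts the transform by `ξ`.
open Asymptotics FourierTransform in
theorem summable_and_scalingSymbol_eq_tsum {Λ : List ℝ} (hΛ : 2 ≤ Λ.length)
    (h0 : ∀ a ∈ Λ, a ≠ 0) (ξ : ℝ) :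
    (Summable fun m : ℤ => scalingFourier Λ (ξ + 2 * Real.pi * m)) ∧
      scalingSymbol Λ ξ = ∑' m : ℤ, scalingFourier Λ (ξ + 2 * Real.pi * m) := by
  have hne : Λ ≠ [] := by rintro rfl; simp at hΛ
  obtain ⟨_, _, C, -, -, -, hC, hb⟩ := (hasDecayingDerivs_scalingFourier hne h0).mono hΛ
  set f : ℝ → ℂ := fun t => (tbSpline Λ t : ℂ) * Complex.exp (-(Complex.I * ξ * t)) with hf
  have hcont : Continuous f :=
    (Complex.continuous_ofReal.comp (continuous_tbSpline hΛ)).mul (by fun_prop)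
  have hF : ∀ w : ℝ, 𝓕 f w = scalingFourier Λ (ξ + 2 * Real.pi * w) := by
    intro w
    rw [Real.fourier_real_eq_integral_exp_smul, scalingFourier, angularFourier]
    congr 1
    funext t
    rw [hf, smul_eq_mul, mul_left_comm, ← Complex.exp_add, mul_comm]
    congr 2
    push_cast
    ring
  -- The constant `0` works because `f` vanishes off a compact set.
  have hfO : f =O[cocompact ℝ] (fun x : ℝ => |x| ^ (-2 : ℝ)) := by
    refine IsBigO.of_bound 0 ?_
    filter_upwards [(isCompact_Icc (a := (0 : ℝ)) (b := Λ.length)).compl_mem_cocompact] with x hx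
    simp [hf, tbSpline_eq_zero Λ hx]
  -- Rests on `|m| ≤ (1 + |ξ|)(1 + |ξ + 2πm|)`.
  have hFO : ∀ m : ℤ, m ≠ 0 → ‖scalingFourier Λ (ξ + 2 * Real.pi * m)‖ ≤
      C * (1 + |ξ|) ^ 2 * ‖|(m : ℝ)| ^ (-2 : ℝ)‖ := by
    intro m hm
    refine (hb _).1.trans ?_
    have hm' : 0 < |(m : ℝ)| := by simpa using hm
    rw [Real.norm_of_nonneg (by positivity), mul_assoc C, Real.rpow_neg hm'.le,
      Real.rpow_two, inv_pow, ← div_eq_mul_inv ((1 + |ξ|) ^ 2)]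
    refine mul_le_mul_of_nonneg_left ?_ hC
    rw [inv_eq_one_div, div_le_div_iff₀ (by positivity) (by positivity), one_mul, ← mul_pow]
    refine pow_le_pow_left₀ hm'.le ?_ 2
    have h1 : |2 * Real.pi * (m : ℝ)| ≤ |ξ + 2 * Real.pi * m| + |ξ| := by
      have := abs_sub (ξ + 2 * Real.pi * m) ξ
      rwa [add_sub_cancel_left] at this
    rw [abs_mul, abs_of_pos (by have := Real.pi_pos; positivity)] at h1
    nlinarith [Real.pi_gt_three, abs_nonneg ξ, abs_nonneg (ξ + 2 * Real.pi * m)]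
  have hsum : Summable fun m : ℤ => scalingFourier Λ (ξ + 2 * Real.pi * m) := by
    refine summable_of_isBigO (Real.summable_abs_int_rpow one_lt_two)
      (IsBigO.of_bound (C * (1 + |ξ|) ^ 2) ?_)
    filter_upwards [(Set.finite_singleton (0 : ℤ)).compl_mem_cofinite] with m hm
    exact hFO m hm
  refine ⟨hsum, ?_⟩
  have := Real.tsum_eq_tsum_fourier_of_rpow_decay_of_summable hcont one_lt_two hfO
    (by simpa only [hF] using hsum) 0
  simp only [hF] at this
  simpa [hf, scalingSymbol] using this

theorem summable_and_scalingSymbol_eq_mul {Λ : List ℝ} (hΛ : 2 ≤ Λ.length)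
    (h0 : ∀ a ∈ Λ, a ≠ 0) (ξ : ℝ) :
    (Summable fun m : ℤ => charReciprocal Λ (ξ + 2 * Real.pi * m)) ∧
      scalingSymbol Λ ξ =
        scalingNumerator Λ ξ * ∑' m : ℤ, charReciprocal Λ (ξ + 2 * Real.pi * m) := by
  have hne : Λ ≠ [] := by rintro rfl; simp at hΛ
  obtain ⟨hs, he⟩ := summable_and_scalingSymbol_eq_tsum hΛ h0 ξ
  obtain ⟨c, hc, hP⟩ := exists_le_norm_scalingNumerator h0
  have hP0 : scalingNumerator Λ ξ ≠ 0 := norm_pos_iff.1 (hc.trans_le (hP ξ))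
  simp only [scalingFourier_eq_mul hne h0, scalingNumerator_add_int] at hs he
  exact ⟨(summable_mul_left_iff hP0).1 hs, he.trans tsum_mul_left⟩

/-! ### Vectors whose characteristic polynomial is close to a power of `ξ² + k²` -/

/-- On the imaginary axis `∏ (iξ - λ_j)` is uniformly close to `(-1)^p (ξ² + k²)^p`. -/
def NearPower (p : ℕ) (k : ℝ) (Λ : List ℝ) : Prop :=
  ∀ ξ : ℝ, ‖((-1) ^ p * ((ξ ^ 2 + k ^ 2) ^ p : ℝ) * charReciprocal Λ ξ : ℂ) - 1‖ ≤ 1 / 2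

namespace NearPower

variable {p : ℕ} {k : ℝ} {Λ : List ℝ}

theorem ne_zero (h : NearPower p k Λ) : ∀ a ∈ Λ, a ≠ 0 := by
  rintro a ha rfl
  -- With a zero entry, the convention `0⁻¹ = 0` makes the product vanish at `ξ = 0`, leaving
  -- distance `1 > 1/2`.
  have h0 : charReciprocal Λ 0 = 0 := by
    refine List.prod_eq_zero (List.mem_map.2 ⟨0, ha, by simp⟩)
  have := h 0
  rw [h0] at this
  norm_num at this

theorem norm_charReciprocal_le (h : NearPower p k Λ) (hk : 0 < k) (ξ : ℝ) :
    ‖charReciprocal Λ ξ‖ ≤ 3 / 2 * ((ξ ^ 2 + k ^ 2) ^ p)⁻¹ := by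
  have hq : 0 < (ξ ^ 2 + k ^ 2) ^ p := by positivity
  have h1 := norm_le_norm_add_norm_sub'
    ((-1) ^ p * ((ξ ^ 2 + k ^ 2) ^ p : ℝ) * charReciprocal Λ ξ : ℂ) 1
  have h2 := h ξ
  rw [norm_mul, norm_mul, norm_pow, norm_neg, norm_one, one_pow, one_mul, Complex.norm_real,
    Real.norm_eq_abs, abs_of_pos hq] at h1
  rw [← div_eq_mul_inv, le_div_iff₀ hq]
  linarith

theorem le_re_charReciprocal (h : NearPower p k Λ) (hk : 0 < k) (ξ : ℝ) :
    1 / 2 * ((ξ ^ 2 + k ^ 2) ^ p)⁻¹ ≤ ((-1) ^ p * charReciprocal Λ ξ).re := by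
  have hq : 0 < (ξ ^ 2 + k ^ 2) ^ p := by positivity
  have h1 := (Complex.abs_re_le_norm _).trans (h ξ)
  rw [show ((-1) ^ p * ((ξ ^ 2 + k ^ 2) ^ p : ℝ) * charReciprocal Λ ξ : ℂ) =
    ((ξ ^ 2 + k ^ 2) ^ p : ℝ) * ((-1) ^ p * charReciprocal Λ ξ) by ring, Complex.sub_re,
    Complex.re_ofReal_mul, Complex.one_re] at h1
  rw [← div_eq_mul_inv, div_le_iff₀ hq]
  linarith [(abs_le.1 h1).1]

/-- The periodization is bounded below by the contribution of the points in `[0, 2π⌈k⌉]`. -/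
theorem le_norm_tsum (h : NearPower p k Λ) (hk : 1 ≤ k) (ξ : ℝ)
    (hs : Summable fun m : ℤ => charReciprocal Λ (ξ + 2 * Real.pi * m)) :
    k * (1 / 2 * ((200 * k ^ 2) ^ p)⁻¹) ≤
      ‖∑' m : ℤ, charReciprocal Λ (ξ + 2 * Real.pi * m)‖ := by
  have hk0 : 0 < k := by linarith
  set F : ℤ → ℝ := fun m => ((-1) ^ p * charReciprocal Λ (ξ + 2 * Real.pi * m)).re with hFdef
  have hF : HasSum F ((-1) ^ p * ∑' m : ℤ, charReciprocal Λ (ξ + 2 * Real.pi * m)).re :=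
    Complex.hasSum_re (hs.hasSum.mul_left _)
  have hF0 : ∀ m, 0 ≤ F m := fun m =>
    le_trans (by positivity) (h.le_re_charReciprocal hk0 (ξ + 2 * Real.pi * m))
  set x : ℝ := ξ / (2 * Real.pi) with hx
  -- Subtracting `⌊x⌋` puts the selected points at `2π(fract x + j)` with `0 ≤ j < ⌈k⌉`.
  let e : ℕ ↪ ℤ := ⟨fun j => j - ⌊x⌋, fun i j hij => by simpa using hij⟩
  have hpi := Real.pi_pos
  have hle : ∀ m ∈ (Finset.range ⌈k⌉₊).map e, 1 / 2 * ((200 * k ^ 2) ^ p)⁻¹ ≤ F m := by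
    intro m hm
    obtain ⟨j, hj, rfl⟩ := Finset.mem_map.1 hm
    refine le_trans ?_ (h.le_re_charReciprocal hk0 _)
    have hej : ξ + 2 * Real.pi * (e j : ℤ) = 2 * Real.pi * (Int.fract x + j) := by
      have hξ : ξ = 2 * Real.pi * x := by rw [hx]; field_simp
      change ξ + 2 * Real.pi * ((j - ⌊x⌋ : ℤ) : ℝ) = _
      rw [Int.fract]
      nth_rewrite 1 [hξ]
      push_cast
      ring
    have hjk : (j : ℝ) + 1 ≤ k + 1 := by
      have h1 : ((j + 1 : ℕ) : ℝ) ≤ (⌈k⌉₊ : ℝ) :=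
        Nat.cast_le.2 (Finset.mem_range.1 hj)
      push_cast at h1
      linarith [Nat.ceil_lt_add_one hk0.le]
    have h0 := Int.fract_nonneg x
    have h1 := Int.fract_lt_one x
    have hy0 : 0 ≤ 2 * Real.pi * (Int.fract x + j) := by positivity
    -- `fract x + j ≤ k + 1 ≤ 2k` and `4π < 14`; then `14² + 1 ≤ 200` explains the constant `200`.
    have hy : 2 * Real.pi * (Int.fract x + j) ≤ 14 * k := by
      nlinarith [Real.pi_lt_four, Real.pi_lt_d2]
    rw [hej]
    gcongr
    nlinarith
  have hsum := hF.summable.sum_le_tsum ((Finset.range ⌈k⌉₊).map e) fun m _ => hF0 m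
  have hcard := Finset.card_nsmul_le_sum _ _ _ hle
  rw [Finset.card_map, Finset.card_range, nsmul_eq_mul] at hcard
  calc k * (1 / 2 * ((200 * k ^ 2) ^ p)⁻¹)
      ≤ ⌈k⌉₊ * (1 / 2 * ((200 * k ^ 2) ^ p)⁻¹) := by
        gcongr; exact Nat.le_ceil k
    _ ≤ ∑' m, F m := hcard.trans hsum
    _ = ((-1) ^ p * ∑' m : ℤ, charReciprocal Λ (ξ + 2 * Real.pi * m)).re := hF.tsum_eq
    _ ≤ ‖(-1) ^ p * ∑' m : ℤ, charReciprocal Λ (ξ + 2 * Real.pi * m)‖ := Complex.re_le_norm _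
    _ = _ := by rw [norm_mul, norm_pow, norm_neg, norm_one, one_pow, one_mul]

/-- Here `δ` involves the lower bound of the numerator, which is not controlled in `k`; it serves
only for nonvanishing and regularity at fixed `k`. -/
theorem exists_le_norm_scalingSymbol (h : NearPower p k Λ) (hΛ : 2 ≤ Λ.length) (hk : 1 ≤ k) :
    ∃ δ > 0, ∀ ξ, δ ≤ ‖scalingSymbol Λ ξ‖ := by
  obtain ⟨c, hc, hP⟩ := exists_le_norm_scalingNumerator h.ne_zero
  refine ⟨c * (k * (1 / 2 * ((200 * k ^ 2) ^ p)⁻¹)), by positivity, fun ξ => ?_⟩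
  obtain ⟨hs, he⟩ := summable_and_scalingSymbol_eq_mul hΛ h.ne_zero ξ
  rw [he, norm_mul]
  exact mul_le_mul (hP ξ) (h.le_norm_tsum hk ξ hs) (by positivity) (norm_nonneg _)

theorem norm_div_le (h : NearPower p k Λ) (hp : 1 ≤ p) (hΛ : 2 ≤ Λ.length) (hk : 1 ≤ k) (ξ : ℝ) :
    ‖scalingFourier Λ ξ / scalingSymbol Λ ξ‖ ≤ 3 * 200 ^ p * (k / (ξ ^ 2 + k ^ 2)) := by
  have hne : Λ ≠ [] := by rintro rfl; simp at hΛ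
  have hk0 : 0 < k := by linarith
  obtain ⟨c, hc, hP⟩ := exists_le_norm_scalingNumerator h.ne_zero
  have hP0 : scalingNumerator Λ ξ ≠ 0 := norm_pos_iff.1 (hc.trans_le (hP ξ))
  obtain ⟨hs, he⟩ := summable_and_scalingSymbol_eq_mul hΛ h.ne_zero ξ
  rw [scalingFourier_eq_mul hne h.ne_zero, he, mul_div_mul_left _ _ hP0, norm_div]
  refine (div_le_div₀ (by positivity) (h.norm_charReciprocal_le hk0 ξ) (by positivity)
    (h.le_norm_tsum hk ξ hs)).trans ?_
  -- One factor `k/(ξ² + k²)` is kept for integrability; the other `r` factors `k²/(ξ² + k²)` are at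
  -- most `1`.
  obtain ⟨r, rfl⟩ : ∃ r, p = r + 1 := ⟨p - 1, by omega⟩
  have hq : 0 < ξ ^ 2 + k ^ 2 := by positivity
  have hle : (k ^ 2) ^ r ≤ (ξ ^ 2 + k ^ 2) ^ r := by
    gcongr; nlinarith [sq_nonneg ξ]
  have e : 3 / 2 * ((ξ ^ 2 + k ^ 2) ^ (r + 1))⁻¹ / (k * (1 / 2 * ((200 * k ^ 2) ^ (r + 1))⁻¹)) =
      3 * 200 ^ (r + 1) * (k / (ξ ^ 2 + k ^ 2)) * ((k ^ 2) ^ r / (ξ ^ 2 + k ^ 2) ^ r) := by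
    rw [mul_pow, pow_succ (ξ ^ 2 + k ^ 2), pow_succ (k ^ 2)]
    field_simp
  rw [e]
  exact mul_le_of_le_one_right (by positivity) (div_le_one_of_le₀ hle (by positivity))

theorem hasDecayingDerivs_div (h : NearPower p k Λ) (hΛ : 2 ≤ Λ.length) (hk : 1 ≤ k) :
    HasDecayingDerivs (fun ξ => scalingFourier Λ ξ / scalingSymbol Λ ξ) 2 := by
  have hne : Λ ≠ [] := by rintro rfl; simp at hΛ
  obtain ⟨δ, hδ, hb⟩ := h.exists_le_norm_scalingSymbol hΛ hk
  have := ((hasDecayingDerivs_scalingFourier hne h.ne_zero).mono hΛ).mul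
    ((hasDecayingDerivs_scalingSymbol Λ).inv hδ hb)
  simpa only [div_eq_mul_inv] using this

/-- The integral of `k/(ξ² + k²)` is `π` for every `k > 0`, and the prefactor `1/(2π)` turns it into
`1/2`. -/
theorem norm_shannonWalter_le (h : NearPower p k Λ) (hp : 1 ≤ p) (hΛ : 2 ≤ Λ.length)
    (hk : 1 ≤ k) (t : ℝ) : ‖shannonWalter Λ t‖ ≤ 3 * 200 ^ p / 2 := by
  have hk0 : 0 < k := by linarith
  have hpi := Real.pi_pos
  have e : ∀ ξ : ℝ, k / (ξ ^ 2 + k ^ 2) = k⁻¹ * (1 + (ξ / k) ^ 2)⁻¹ := by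
    intro ξ
    have hq : 0 < ξ ^ 2 + k ^ 2 := by positivity
    have hq' : 0 < 1 + (ξ / k) ^ 2 := by positivity
    field_simp
    ring
  have hint : Integrable fun ξ : ℝ => 3 * 200 ^ p * (k / (ξ ^ 2 + k ^ 2)) := by
    simp only [e]
    exact ((integrable_inv_one_add_sq.comp_div hk0.ne').const_mul _).const_mul _
  have hval : ∫ ξ : ℝ, 3 * 200 ^ p * (k / (ξ ^ 2 + k ^ 2)) = 3 * 200 ^ p * Real.pi := by
    simp only [e, integral_const_mul]
    rw [Measure.integral_comp_div (fun x : ℝ => (1 + x ^ 2)⁻¹) k, integral_univ_inv_one_add_sq,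
      abs_of_pos hk0, smul_eq_mul, inv_mul_cancel_left₀ hk0.ne']
  have hle := norm_integral_le_of_norm_le hint
    (f := fun ξ : ℝ => Complex.exp (Complex.I * ξ * t) *
      (scalingFourier Λ ξ / scalingSymbol Λ ξ)) (Eventually.of_forall fun ξ => by
        rw [norm_mul, show Complex.I * ξ * t = ((ξ * t : ℝ) : ℂ) * Complex.I by push_cast; ring,
          Complex.norm_exp_ofReal_mul_I, one_mul]
        exact h.norm_div_le hp hΛ hk ξ)
  rw [hval] at hle
  have hn : ‖(1 / (2 * Real.pi) : ℂ)‖ = 1 / (2 * Real.pi) := by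
    simp [abs_of_pos hpi]
  rw [shannonWalter, norm_mul, hn]
  refine (mul_le_mul_of_nonneg_left hle (by positivity)).trans_eq ?_
  field_simp

end NearPower

/-! ### The two families -/

open Topology in
/-- `-(iξ - a)(iξ - b)` is uniformly close to `ξ² + k²` when `a = k + O(1)`, `b = -k + O(1)`. -/
theorem tendsto_quadratic_factor (u v : ℝ) :
    Tendsto (fun x : ℝ × ℝ => -(((x.2 ^ 2 + x.1 ^ 2 : ℝ) : ℂ) *
      ((Complex.I * x.2 - (x.1 + u : ℝ))⁻¹ * (Complex.I * x.2 - (-x.1 + v : ℝ))⁻¹)))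
      (atTop ×ˢ ⊤) (𝓝 1) := by
  have hk : Tendsto (fun x : ℝ × ℝ => x.1) (atTop ×ˢ (⊤ : Filter ℝ)) atTop := tendsto_fst
  have hev : ∀ᶠ x : ℝ × ℝ in atTop ×ˢ (⊤ : Filter ℝ), 1 ≤ x.1 := hk.eventually_ge_atTop 1
  set D : ℝ := |u| + |v| + |u * v| with hD
  -- The reciprocal is treated first: its numerator is a polynomial, and its limit `1` can be
  -- inverted.
  have hmain : Tendsto (fun x : ℝ × ℝ =>
      -((Complex.I * x.2 - (x.1 + u : ℝ)) * (Complex.I * x.2 - (-x.1 + v : ℝ))) /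
        ((x.2 ^ 2 + x.1 ^ 2 : ℝ) : ℂ)) (atTop ×ˢ ⊤) (𝓝 1) := by
    rw [tendsto_iff_norm_sub_tendsto_zero]
    have hlim : Tendsto (fun x : ℝ × ℝ => 2 * D * x.1⁻¹) (atTop ×ˢ (⊤ : Filter ℝ)) (𝓝 0) := by
      simpa using (tendsto_inv_atTop_zero.comp hk).const_mul (2 * D)
    refine squeeze_zero' (Eventually.of_forall fun _ => norm_nonneg _) ?_ hlim
    filter_upwards [hev] with x hx
    obtain ⟨k, ξ⟩ := x
    simp only at hx ⊢
    have hk0 : 0 < k := by linarith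
    have hq : 0 < ξ ^ 2 + k ^ 2 := by positivity
    have hqc : ((ξ ^ 2 + k ^ 2 : ℝ) : ℂ) ≠ 0 := by exact_mod_cast hq.ne'
    -- The quadratic terms cancel. What remains is `O(k + |ξ|)`, so the quotient is `O(1/k)`
    -- uniformly in `ξ`.
    have e : -((Complex.I * ξ - (k + u : ℝ)) * (Complex.I * ξ - (-k + v : ℝ))) /
        ((ξ ^ 2 + k ^ 2 : ℝ) : ℂ) - 1 =
        (((k * (u - v) - u * v : ℝ) : ℂ) + ((ξ * (u + v) : ℝ) : ℂ) * Complex.I) /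
          ((ξ ^ 2 + k ^ 2 : ℝ) : ℂ) := by
      rw [div_sub_one hqc]
      congr 1
      push_cast
      linear_combination (-(ξ : ℂ) ^ 2) * Complex.I_sq
    rw [e, norm_div, Complex.norm_real, Real.norm_eq_abs, abs_of_pos hq, div_le_iff₀ hq]
    have n1 : ‖((k * (u - v) - u * v : ℝ) : ℂ)‖ ≤ k * D := by
      rw [Complex.norm_real, Real.norm_eq_abs]
      refine (abs_sub _ _).trans ?_
      rw [abs_mul, abs_of_pos hk0]
      have := abs_sub u v
      have : 0 ≤ |u * v| := abs_nonneg _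
      nlinarith
    have n2 : ‖((ξ * (u + v) : ℝ) : ℂ) * Complex.I‖ ≤ |ξ| * D := by
      rw [norm_mul, Complex.norm_I, mul_one, Complex.norm_real, Real.norm_eq_abs, abs_mul]
      refine mul_le_mul_of_nonneg_left ?_ (abs_nonneg ξ)
      linarith [abs_add_le u v, abs_nonneg (u * v)]
    refine (norm_add_le_of_le n1 n2).trans ?_
    have hD0 : 0 ≤ D := by positivity
    have : (k + |ξ|) * k ≤ 2 * (ξ ^ 2 + k ^ 2) := by
      nlinarith [sq_abs ξ, sq_nonneg (k - |ξ|)]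
    have h2 : k + |ξ| ≤ 2 * k⁻¹ * (ξ ^ 2 + k ^ 2) := by
      rw [show 2 * k⁻¹ * (ξ ^ 2 + k ^ 2) = 2 * (ξ ^ 2 + k ^ 2) / k by ring, le_div_iff₀ hk0]
      exact this
    calc k * D + |ξ| * D = D * (k + |ξ|) := by ring
      _ ≤ D * (2 * k⁻¹ * (ξ ^ 2 + k ^ 2)) := mul_le_mul_of_nonneg_left h2 hD0
      _ = 2 * D * k⁻¹ * (ξ ^ 2 + k ^ 2) := by ring
  have := hmain.inv₀ one_ne_zero
  rw [inv_one] at this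
  refine this.congr fun x => ?_
  rw [inv_div, ← mul_inv, div_eq_mul_inv, inv_neg, mul_neg]

theorem charReciprocal_append (Λ M : List ℝ) (ξ : ℝ) :
    charReciprocal (Λ ++ M) ξ = charReciprocal Λ ξ * charReciprocal M ξ := by
  simp [charReciprocal]

theorem list_prod_map_neg_mul {ι : Type*} (l : List ι) (q : ℂ) (F : ι → ℂ) :
    (l.map fun j => -(q * F j)).prod = (-1) ^ l.length * q ^ l.length * (l.map F).prod := by
  induction l with
  | nil => simp
  | cons j l ih =>
    simp only [List.map_cons, List.prod_cons, List.length_cons, ih]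
    ring

/-- A family of vectors made of `p` pairs `k + O(1)`, `-k + O(1)`. -/
theorem eventually_nearPower {Λ : ℝ → List ℝ} (p : ℕ) (u v : ℕ → ℝ)
    (h : ∀ k ξ, charReciprocal (Λ k) ξ = ((List.range p).map fun j : ℕ =>
      (Complex.I * ξ - (k + u j : ℝ))⁻¹ * (Complex.I * ξ - (-k + v j : ℝ))⁻¹).prod) :
    ∀ᶠ k in atTop, NearPower p k (Λ k) := by
  have hlim := tendsto_list_prod (List.range p) fun j _ => tendsto_quadratic_factor (u j) (v j)
  simp only [List.map_const', List.prod_replicate, one_pow] at hlim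
  have hball := hlim.eventually (Metric.closedBall_mem_nhds (1 : ℂ) (ε := 1 / 2) (by norm_num))
  -- Convergence along `atTop ×ˢ ⊤` is convergence in `k` uniform in `ξ`.
  rw [prod_top, eventually_comap] at hball
  filter_upwards [hball] with k hk ξ
  have := hk (k, ξ) rfl
  rw [dist_eq_norm] at this
  rw [list_prod_map_neg_mul, List.length_range] at this
  rw [h, Complex.ofReal_pow]
  exact this

theorem eventually_nearPower_annulusVector (n p : ℕ) :
    ∀ᶠ k in atTop, NearPower p k (annulusVector n p k) := by
  refine eventually_nearPower p (fun j => 2 * (j : ℝ)) (fun j => -(n : ℝ) + 2 + 2 * j)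
    fun k ξ => ?_
  rw [annulusVector, charReciprocal_append, List.prod_map_mul]
  simp only [charReciprocal, List.map_map]
  congr 3
  funext j
  simp only [Function.comp_apply]
  congr 2
  push_cast
  ring

theorem eventually_nearPower_stripVector (p : ℕ) :
    ∀ᶠ k in atTop, NearPower p k (stripVector p k) := by
  refine eventually_nearPower p (fun _ => 0) (fun _ => 0) fun k ξ => ?_
  -- The swap is needed because `stripVector` lists the entries `-k` first.
  rw [stripVector, charReciprocal_append, List.prod_map_mul, mul_comm]
  simp [charReciprocal]

end

/-- For either family of vectors `Λ_k`: the Shannon–Walter spline is well defined for large `k`,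
its Fourier transform is `O(1/k)` uniformly in `ξ`, and it is `O(1)` uniformly in `t`. -/
theorem mainTheorem8 (n p : ℕ) (hp : 1 ≤ p) (Λ : ℝ → List ℝ)
    (hΛ : Λ = annulusVector n p ∨ Λ = stripVector p) :
    (∀ᶠ k : ℝ in atTop,
      (∀ ξ : ℝ, scalingSymbol (Λ k) ξ ≠ 0) ∧
      Integrable (fun ξ : ℝ => scalingFourier (Λ k) ξ / scalingSymbol (Λ k) ξ) ∧
      Integrable (shannonWalter (Λ k)) ∧
      ∀ ξ : ℝ, angularFourier (shannonWalter (Λ k)) ξ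
        = scalingFourier (Λ k) ξ / scalingSymbol (Λ k) ξ) ∧
    (∃ C : ℝ, ∀ᶠ k : ℝ in atTop, ∀ ξ : ℝ,
      ‖angularFourier (shannonWalter (Λ k)) ξ‖ ≤ C / k) ∧
    (∃ C : ℝ, ∀ᶠ k : ℝ in atTop, ∀ t : ℝ, ‖shannonWalter (Λ k) t‖ ≤ C) := by
  have hnear : ∀ᶠ k in atTop, NearPower p k (Λ k) := by
    rcases hΛ with rfl | rfl
    · exact eventually_nearPower_annulusVector n p
    · exact eventually_nearPower_stripVector p
  have hlen : ∀ k, 2 ≤ (Λ k).length := by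
    rcases hΛ with rfl | rfl <;> intro k <;> simp [annulusVector, stripVector] <;> omega
  have hwell : ∀ᶠ k in atTop, 1 ≤ k ∧ NearPower p k (Λ k) ∧ Integrable (shannonWalter (Λ k)) ∧
      ∀ ξ, angularFourier (shannonWalter (Λ k)) ξ
        = scalingFourier (Λ k) ξ / scalingSymbol (Λ k) ξ := by
    filter_upwards [hnear, eventually_ge_atTop 1] with k h hk
    exact ⟨hk, h, integrable_and_angularFourier_inverse (h.hasDecayingDerivs_div (hlen k) hk)
      fun t => rfl⟩
  refine ⟨?_, ⟨3 * 200 ^ p, ?_⟩, ⟨3 * 200 ^ p / 2, ?_⟩⟩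
  · filter_upwards [hwell] with k ⟨hk, h, hS⟩
    obtain ⟨δ, hδ, hb⟩ := h.exists_le_norm_scalingSymbol (hlen k) hk
    exact ⟨fun ξ => norm_pos_iff.1 (hδ.trans_le (hb ξ)),
      (h.hasDecayingDerivs_div (hlen k) hk).integrable, hS⟩
  · filter_upwards [hwell] with k ⟨hk, h, hS⟩ ξ
    rw [hS.2 ξ]
    refine (h.norm_div_le hp (hlen k) hk ξ).trans ?_
    rw [← mul_one_div (3 * 200 ^ p : ℝ)]
    have hk0 : 0 < k := by linarith
    refine mul_le_mul_of_nonneg_left ?_ (by positivity)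
    -- What remains is `k/(ξ² + k²) ≤ 1/k`.
    rw [div_le_div_iff₀ (by positivity) hk0]
    nlinarith [sq_nonneg ξ]
  · filter_upwards [hwell] with k ⟨hk, h, _⟩ t
    exact h.norm_shannonWalter_le hp (hlen k) hk t
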